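/- Let $n_1,n_2$ be natural numbers and let $\mathbb{R}^{n_1\times n_2}$ carry the trace inner product $\langle A,B\rangle=\operatorname{tr}(A^TB)$, with Frobenius norm $\|\cdot\|_F$ and corresponding distance $\operatorname{dist}(\cdot\,;\cdot)$. For $X\in\mathbb{R}^{n_1\times n_2}$ let $\sigma_1(X)\ge\sigma_2(X)\ge\dots\ge\sigma_n(X)\ge 0$, $n=\min\{n_1,n_2\}$, be its singular values, let $\sigma(X)=\{\sigma_1(X),\dots,\sigma_n(X)\}$, and let $\|X\|_*=\sum_{i=1}^n\sigma_i(X)$ be its nuclear norm. For a convex function $g:\mathbb{R}^{n_1\times n_2}\to\mathbb{R}$ put $\partial g(X)=\{V\mid g(U)-g(X)\ge\langle V,U-X\rangle\ \text{for all }U\}$, $\operatorname{gph}\partial g=\{(X,V)\mid V\in\partial g(X)\}$ and $(\partial g)^{-1}(V)=\{X\mid V\in\partial g(X)\}$. **Lemma 4.2.** Let $(\bar X,\bar Y)\in\operatorname{gph}\partial\|\cdot\|_*$ and let $\gamma=\max\big((\sigma(\bar Y)\setminus\{1\})\cup\{0\}\big)$ be the subdominant singular value of $\bar Y$. Then $\gamma<1$,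 and for every $X\in\mathbb{R}^{n_1\times n_2}\setminus\{0\}$ $$\|X\|_*-\|\bar X\|_*-\langle\bar Y,X-\bar X\rangle\ \ge\ \frac{1-\gamma^2}{2\|X\|_*\,(1+(1+\gamma)^2)}\,\big[\operatorname{dist}(X;(\partial\|\cdot\|_*)^{-1}(\bar Y))\big]^2 .$$ Consequently, for every $X\in\mathbb{R}^{n_1\times n_2}\setminus\{0\}$ $$\|X\|_*-\|\bar X\|_*-\langle\bar Y,X-\bar X\rangle\ \ge\ \frac{1-\gamma}{5\|X\|_*}\,\big[\operatorname{dist}(X;(\partial\|\cdot\|_*)^{-1}(\bar Y))\big]^2 .$$ Finally, let $p$ be the number of indices $i\in\{1,\dots,n\}$ with $\sigma_i(\bar Y)=1$ and let $$\mathcal{M}_*=\{Y\in\mathbb{R}^{n_1\times n_2}\mid \sigma_1(Y)=\dots=\sigma_p(Y)=1\}.$$ Then the nuclear norm satisfies the quadratic growth condition around $(\bar X,\bar Y)$ for $\mathcal{M}_*$, that is: $\bar Y\in\mathcal{M}_*$, and there exist $\eta,\kappa>0$ such that for every $(X,Y)\in\operatorname{gph}\partial\|\cdot\|_*$ in the ball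 of radius $\eta$ around $(\bar X,\bar Y)$ with $Y\in\mathcal{M}_*$ there is $\varepsilon>0$ (which may depend on $(X,Y)$) with $$\|U\|_*-\|X\|_*-\langle Y,U-X\rangle\ \ge\ \frac{\kappa}{2}\,\big[\operatorname{dist}(U;(\partial\|\cdot\|_*)^{-1}(Y))\big]^2\quad\text{for all }U\text{ with }\|U-X\|_F<\varepsilon .$$ -/

import Mathlib

/-! The space `ℝ^{m × n}` carries the trace inner product `⟪A, B⟫ = tr (Aᵀ B)` and the Frobenius
norm that it induces. -/

attribute [local instance] Matrix.frobeniusNormedAddCommGroup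

theorem frobenius_norm_sq {m n : ℕ} (A : Matrix (Fin m) (Fin n) ℝ) :
    ‖A‖ ^ 2 = (A.transpose * A).trace := by
  have h0 : 0 ≤ ∑ i, ∑ j, ‖A i j‖ ^ (2 : ℝ) := by positivity
  rw [Matrix.frobenius_norm_def, ← Real.rpow_natCast, ← Real.rpow_mul h0]
  norm_num
  simp only [Matrix.trace, Matrix.diag, Matrix.mul_apply, Matrix.transpose_apply]
  rw [Finset.sum_comm]
  exact Finset.sum_congr rfl fun _ _ => Finset.sum_congr rfl fun _ _ => pow_two _

/-- The trace inner product `⟪A, B⟫ = tr (Aᵀ B)` on real matrices, inducing the Frobenius norm. -/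
noncomputable abbrev frobeniusInnerProductSpace {m n : ℕ} :
    InnerProductSpace ℝ (Matrix (Fin m) (Fin n) ℝ) :=
  { (Matrix.frobeniusNormedSpace : NormedSpace ℝ (Matrix (Fin m) (Fin n) ℝ)) with
    inner := fun A B => (A.transpose * B).trace
    norm_sq_eq_re_inner := fun A => frobenius_norm_sq A
    conj_inner_symm := fun A B => by
      change (B.transpose * A).trace = (A.transpose * B).trace
      rw [← Matrix.trace_transpose, Matrix.transpose_mul, Matrix.transpose_transpose]
    add_left := fun A B C => by
      change ((A + B).transpose * C).trace = _
      rw [Matrix.transpose_add, Matrix.add_mul, Matrix.trace_add]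
    smul_left := fun A B r => by
      change ((r • A).transpose * B).trace = r * (A.transpose * B).trace
      rw [Matrix.transpose_smul, Matrix.smul_mul, Matrix.trace_smul, smul_eq_mul] }

attribute [local instance] frobeniusInnerProductSpace

section ConvexAnalysis

/-- The convex subdifferential `∂g(x) = {v | g(u) - g(x) ≥ ⟪v, u - x⟫ for all u}` of a finite
function `g` (the dual space is identified with the space through the inner product). -/
def subdifferential {E : Type*} [NormedAddCommGroup E] [InnerProductSpace ℝ E]
    (g : E → ℝ) (x : E) : Set E :=
  {v | ∀ u : E, inner ℝ v (u - x) ≤ g u - g x}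

/-- The inverse `(∂g)⁻¹(y) = {x | y ∈ ∂g(x)}` of the subdifferential mapping. -/
def subdifferentialInv {E : Type*} [NormedAddCommGroup E] [InnerProductSpace ℝ E]
    (g : E → ℝ) (y : E) : Set E :=
  {x | y ∈ subdifferential g x}

/-- Quadratic growth condition of `g` at `x` for `y` with modulus `κ`. -/
def QuadraticGrowthAt {E : Type*} [NormedAddCommGroup E] [InnerProductSpace ℝ E]
    (g : E → ℝ) (x y : E) (κ : ℝ) : Prop :=
  ∃ ε > 0, ∀ u ∈ Metric.ball x ε,
    κ / 2 * Metric.infDist u (subdifferentialInv g y) ^ 2 ≤ g u - g x - inner ℝ y (u - x)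

/-- Quadratic growth condition of `g` around `(x₀, y₀) ∈ gph ∂g` for a set `M` containing `y₀`:
the quadratic growth condition holds, with one and the same modulus `κ`, at every `x` for every
`y ∈ M` such that `(x, y)` is in the graph of `∂g` and close enough to `(x₀, y₀)`. -/
def QuadraticGrowthAround {E : Type*} [NormedAddCommGroup E] [InnerProductSpace ℝ E]
    (g : E → ℝ) (x₀ y₀ : E) (M : Set E) : Prop :=
  y₀ ∈ subdifferential g x₀ ∧ y₀ ∈ M ∧
    ∃ η > 0, ∃ κ > 0, ∀ x y : E, y ∈ subdifferential g x →
      (x, y) ∈ Metric.ball (x₀, y₀) η → y ∈ M → QuadraticGrowthAt g x y κ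

end ConvexAnalysis

section SingularValues

/-- The singular values of `X` in nonincreasing order, indexed from `0`; those of an `n₁ × n₂`
matrix are the ones with index less than `min n₁ n₂`, and all later ones are `0`. -/
noncomputable def sv {n₁ n₂ : ℕ} (X : Matrix (Fin n₁) (Fin n₂) ℝ) (i : ℕ) : ℝ :=
  (Matrix.toEuclideanLin X).singularValues i

/-- The nuclear norm: the sum of the singular values. -/
noncomputable def nuclearNorm {n₁ n₂ : ℕ} (X : Matrix (Fin n₁) (Fin n₂) ℝ) : ℝ :=
  ∑ i ∈ Finset.range (min n₁ n₂), sv X i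

/-- The subdominant singular value `max (σ(Y) \ {1} ∪ {0})`. -/
noncomputable def subdominant {n₁ n₂ : ℕ} (Y : Matrix (Fin n₁) (Fin n₂) ℝ) : ℝ :=
  (insert 0 (((Finset.range (min n₁ n₂)).image (sv Y)).erase 1)).max' (Finset.insert_nonempty _ _)

/-- The number `p(Y)` of singular values of `Y` that are equal to `1`. -/
noncomputable def numOnes {n₁ n₂ : ℕ} (Y : Matrix (Fin n₁) (Fin n₂) ℝ) : ℕ :=
  ((Finset.range (min n₁ n₂)).filter fun i => sv Y i = 1).card

/-- The set of all matrices whose `p(Y₀)` largest singular values are equal to `1`. -/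
def topOnes {n₁ n₂ : ℕ} (Y₀ : Matrix (Fin n₁) (Fin n₂) ℝ) : Set (Matrix (Fin n₁) (Fin n₂) ℝ) :=
  {Y | ∀ i < numOnes Y₀, sv Y i = 1}

end SingularValues

/-!
Write `δ(X) = ‖X‖_* - ⟪Y, X⟫`. A matrix `Y` is a subgradient of the nuclear norm at `X₀` exactly
when `Y` is a contraction and `δ(X₀) = 0` (`mem_subdifferential_nuclearNorm_iff`), so the left-hand
side of both growth inequalities is `δ(X)`, and `(∂‖·‖_*)⁻¹(Y)` is the zero set of `δ`.

Let `P` be the orthogonal projection onto the span of the right singular vectors of `Y` with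
singular value `1`, and let `γ` be the subdominant singular value of `Y`. Given a singular value
decomposition `X = ∑ σᵢ uᵢ vᵢᵀ`, the matrix `Z = ∑ σᵢ (Y P vᵢ)(P vᵢ)ᵀ` is a zero of `δ`, since
`Y` is isometric on the range of `P`. For each pair of unit vectors one has
`‖u vᵀ - (Y P v)(P v)ᵀ‖ ≤ ‖u - Y v‖ + (1 + γ) ‖v - P v‖`, while
`2 (1 - ⟪u, Y v⟫) = ‖u - Y v‖² + (1 - ‖Y v‖²) ≥ ‖u - Y v‖² + (1 - γ²) ‖v - P v‖²`, and the
Cauchy-Schwarz inequality in the plane compares the two (`norm_outer_sub_outer_sq_le`). A second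
Cauchy-Schwarz inequality, with weights `σᵢ`, sums these estimates to the bound on
`dist (X, (∂‖·‖_*)⁻¹(Y))²` (`infDist_sq_le`).

For the growth condition around `(X₀, Y₀)` the same bound is used at the nearby `Y ∈ topOnes Y₀`.
By Weyl's inequality (`singularValues_le_add`) the singular values of `Y` after the leading ones
exceed `subdominant Y₀` by at most `‖Y - Y₀‖`, so `1 - subdominant Y` is bounded away from `0`;
and the nuclear norm is bounded near `X₀`.
-/

open scoped RealInnerProductSpace

/-! ### Singular vectors of linear maps and Weyl's inequality -/

section LinearMaps

variable {E F : Type*} [NormedAddCommGroup E] [InnerProductSpace ℝ E]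
  [NormedAddCommGroup F] [InnerProductSpace ℝ F]

/-- A map sending an orthonormal basis to an orthogonal family of vectors of norm at most one is a
contraction. -/
theorem norm_sum_inner_smul_le {n : ℕ} (v : OrthonormalBasis (Fin n) ℝ E) {u : Fin n → F}
    (hu : ∀ i j, i ≠ j → ⟪u i, u j⟫ = 0) (hu1 : ∀ i, ‖u i‖ ≤ 1) (x : E) :
    ‖∑ i, ⟪v i, x⟫ • u i‖ ≤ ‖x‖ := by
  rw [← sq_le_sq₀ (norm_nonneg _) (norm_nonneg _), ← real_inner_self_eq_norm_sq, sum_inner,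
    ← v.sum_sq_norm_inner_right]
  refine Finset.sum_le_sum fun i _ => ?_
  rw [inner_sum, Finset.sum_eq_single i]
  · rw [inner_smul_left, inner_smul_right, real_inner_self_eq_norm_sq, Real.norm_eq_abs, sq_abs,
      conj_trivial, ← mul_assoc, ← pow_two]
    exact mul_le_of_le_one_right (sq_nonneg _) (pow_le_one₀ (norm_nonneg _) (hu1 i))
  · intro j _ hj
    rw [inner_smul_left, inner_smul_right, hu i j hj.symm, mul_zero, mul_zero]
  · simp

variable [FiniteDimensional ℝ E] [FiniteDimensional ℝ F]

theorem exists_rightSingularBasis (T : E →ₗ[ℝ] F) {n : ℕ} (hn : Module.finrank ℝ E = n) :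
    ∃ v : OrthonormalBasis (Fin n) ℝ E,
      ∀ i j, ⟪T (v i), T (v j)⟫ = if i = j then T.singularValues i ^ 2 else 0 := by
  refine ⟨T.isSymmetric_adjoint_comp_self.eigenvectorBasis hn, fun i j => ?_⟩
  rw [← LinearMap.adjoint_inner_right, ← LinearMap.comp_apply,
    T.isSymmetric_adjoint_comp_self.apply_eigenvectorBasis, inner_smul_right,
    OrthonormalBasis.inner_eq_ite, T.sq_singularValues_fin hn]
  split_ifs with h <;> simp [h]

theorem norm_sq_map_of_rightSingularBasis {T : E →ₗ[ℝ] F} {n : ℕ}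
    {v : OrthonormalBasis (Fin n) ℝ E}
    (hv : ∀ i j, ⟪T (v i), T (v j)⟫ = if i = j then T.singularValues i ^ 2 else 0) (x : E) :
    ‖T x‖ ^ 2 = ∑ i : Fin n, T.singularValues i ^ 2 * ⟪v i, x⟫ ^ 2 := by
  conv_lhs => rw [← v.sum_repr' x]
  rw [← real_inner_self_eq_norm_sq, map_sum, sum_inner]
  refine Finset.sum_congr rfl fun i _ => ?_
  rw [inner_sum, Finset.sum_eq_single i]
  · simp only [map_smul, inner_smul_left, inner_smul_right, hv, if_true]
    simp; ring
  · intro j _ hj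
    simp only [map_smul, inner_smul_left, inner_smul_right, hv, if_neg (Ne.symm hj)]
    simp
  · simp

/-- Singular value decomposition of a linear map. The left singular vectors are indexed like the
right ones; those belonging to a zero singular value are not normalized. -/
theorem exists_singularValueDecomposition (T : E →ₗ[ℝ] F) {n : ℕ}
    (hn : Module.finrank ℝ E = n) :
    ∃ (v : OrthonormalBasis (Fin n) ℝ E) (u : Fin n → F),
      (∀ i, T (v i) = T.singularValues i • u i) ∧ (∀ i j, i ≠ j → ⟪u i, u j⟫ = 0) ∧
      (∀ i, ‖u i‖ ≤ 1) ∧ ∀ i : Fin n, T.singularValues i ≠ 0 → ‖u i‖ = 1 := by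
  obtain ⟨v, hv⟩ := exists_rightSingularBasis T hn
  have hnorm (i) : ‖T (v i)‖ = T.singularValues i := by
    have := hv i i
    rw [if_pos rfl, real_inner_self_eq_norm_sq] at this
    exact (sq_eq_sq₀ (norm_nonneg _) (T.singularValues_nonneg _)).1 this
  have hone (i : Fin n) (hi : T.singularValues i ≠ 0) :
      ‖(T.singularValues i)⁻¹ • T (v i)‖ = 1 := by
    rw [norm_smul, hnorm, Real.norm_of_nonneg (inv_nonneg.2 (T.singularValues_nonneg _)),
      inv_mul_cancel₀ hi]
  refine ⟨v, fun i => (T.singularValues i)⁻¹ • T (v i), fun i => ?_, fun i j hij => ?_,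
    fun i => ?_, hone⟩
  · by_cases hi : T.singularValues i = 0
    · rw [hi, zero_smul, ← norm_eq_zero, hnorm, hi]
    · rw [smul_inv_smul₀ hi]
  · rw [inner_smul_left, inner_smul_right, hv, if_neg hij, mul_zero, mul_zero]
  · by_cases hi : T.singularValues i = 0
    · simp [hi]
    · exact (hone i hi).le

/-- Weyl's inequality: singular values are 1-Lipschitz in the operator norm. The proof compares both
maps on a vector in the span of the first `k + 1` right singular vectors of `S` that is orthogonal
to the first `k` right singular vectors of `T`. -/
theorem singularValues_le_add (S T : E →ₗ[ℝ] F) {c : ℝ} (hc : 0 ≤ c)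
    (h : ∀ x, ‖S x - T x‖ ≤ c * ‖x‖) (k : ℕ) :
    S.singularValues k ≤ T.singularValues k + c := by
  rcases le_or_gt (Module.finrank ℝ E) k with hk | hk
  · rw [S.singularValues_of_finrank_le hk]
    exact add_nonneg (T.singularValues_nonneg k) hc
  obtain ⟨n, hn⟩ : ∃ n, Module.finrank ℝ E = n := ⟨_, rfl⟩
  rw [hn] at hk
  obtain ⟨v, hv⟩ := exists_rightSingularBasis S hn
  obtain ⟨w, hw⟩ := exists_rightSingularBasis T hn
  let L : E →ₗ[ℝ] ({i : Fin n // (i : ℕ) < k} ⊕ {i : Fin n // k < (i : ℕ)}) → ℝ :=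
    LinearMap.pi (Sum.elim (fun i => (innerₛₗ ℝ (w i))) (fun i => (innerₛₗ ℝ (v i))))
  -- The number of equations is `k + (n - 1 - k) < n`.
  have hker : L.ker ≠ ⊥ := by
    apply LinearMap.ker_ne_bot_of_finrank_lt
    rw [Module.finrank_fintype_fun_eq_card, hn, Fintype.card_sum]
    have h1 : Fintype.card {i : Fin n // (i : ℕ) < k} = k := by
      rw [Fintype.card_subtype, Fin.card_filter_val_lt, min_eq_right hk.le]
    have h2 : Fintype.card {i : Fin n // k < (i : ℕ)} = n - 1 - k := by
      rw [Fintype.card_subtype, ← Fin.card_Ioi ⟨k, hk⟩]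
      congr 1
      ext i
      simp [Fin.lt_def]
    omega
  obtain ⟨x, hxL, hx0⟩ := (Submodule.ne_bot_iff _).1 hker
  have hxL' : L x = 0 := hxL
  have hwx (i : Fin n) (hi : (i : ℕ) < k) : ⟪w i, x⟫ = 0 := congrFun hxL' (Sum.inl ⟨i, hi⟩)
  have hvx (i : Fin n) (hi : k < (i : ℕ)) : ⟪v i, x⟫ = 0 := congrFun hxL' (Sum.inr ⟨i, hi⟩)
  have hS : (S.singularValues k * ‖x‖) ^ 2 ≤ ‖S x‖ ^ 2 := by
    rw [norm_sq_map_of_rightSingularBasis hv, mul_pow, ← v.sum_sq_norm_inner_right, Finset.mul_sum]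
    refine Finset.sum_le_sum fun i _ => ?_
    rw [Real.norm_eq_abs, sq_abs]
    rcases le_or_gt (i : ℕ) k with hi | hi
    · gcongr
      · exact S.singularValues_nonneg _
      · exact S.singularValues_antitone hi
    · simp [hvx i hi]
  have hT : ‖T x‖ ^ 2 ≤ (T.singularValues k * ‖x‖) ^ 2 := by
    rw [norm_sq_map_of_rightSingularBasis hw, mul_pow, ← w.sum_sq_norm_inner_right, Finset.mul_sum]
    refine Finset.sum_le_sum fun i _ => ?_
    rw [Real.norm_eq_abs, sq_abs]
    rcases lt_or_ge (i : ℕ) k with hi | hi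
    · simp [hwx i hi]
    · gcongr
      · exact T.singularValues_nonneg _
      · exact T.singularValues_antitone hi
  have hS' := (sq_le_sq₀ (mul_nonneg (S.singularValues_nonneg k) (norm_nonneg _))
    (norm_nonneg _)).1 hS
  have hT' := (sq_le_sq₀ (norm_nonneg _)
    (mul_nonneg (T.singularValues_nonneg k) (norm_nonneg _))).1 hT
  have hx : 0 < ‖x‖ := norm_pos_iff.2 hx0
  refine le_of_mul_le_mul_right ?_ hx
  have := norm_le_norm_add_norm_sub' (S x) (T x)
  linarith [h x]

/-- If every singular value of `T` other than `1` is at most `γ`, then the orthogonal projection `P`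
onto the right singular vectors with singular value `1` splits both `‖x‖ ^ 2` and `‖T x‖ ^ 2`;
`T` is isometric on the range of `P` and contracts by the factor `γ` on its complement. -/
theorem exists_splitting (T : E →ₗ[ℝ] F) {γ : ℝ} (hγ : 0 ≤ γ)
    (h : ∀ i < Module.finrank ℝ E, T.singularValues i ≠ 1 → T.singularValues i ≤ γ) :
    ∃ P : E → E, ∀ x, ‖x‖ ^ 2 = ‖P x‖ ^ 2 + ‖x - P x‖ ^ 2 ∧
      ‖T x‖ ^ 2 = ‖P x‖ ^ 2 + ‖T (x - P x)‖ ^ 2 ∧ ‖T (P x)‖ = ‖P x‖ ∧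
      ‖T (x - P x)‖ ≤ γ * ‖x - P x‖ := by
  obtain ⟨v, hv⟩ := exists_rightSingularBasis T rfl
  let P : E → E := fun x =>
    ∑ i : Fin (Module.finrank ℝ E), (if T.singularValues i = 1 then ⟪v i, x⟫ else 0) • v i
  have hP (x : E) (i : Fin (Module.finrank ℝ E)) :
      ⟪v i, P x⟫ = if T.singularValues i = 1 then ⟪v i, x⟫ else 0 := by
    simp only [P, inner_sum, inner_smul_right, OrthonormalBasis.inner_eq_ite]
    simp
  have hnorm (x : E) : ‖x‖ ^ 2 = ∑ i, ⟪v i, x⟫ ^ 2 := by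
    rw [← v.sum_sq_norm_inner_right]
    simp
  have hnormT := norm_sq_map_of_rightSingularBasis hv
  refine ⟨P, fun x => ⟨?_, ?_, ?_, ?_⟩⟩
  · simp only [hnorm, inner_sub_right, hP, ← Finset.sum_add_distrib]
    refine Finset.sum_congr rfl fun i _ => ?_
    split_ifs <;> ring
  · simp only [hnorm (P x), hnormT, inner_sub_right, hP, ← Finset.sum_add_distrib]
    refine Finset.sum_congr rfl fun i _ => ?_
    split_ifs with hi
    · simp [hi]
    · ring
  · rw [← sq_eq_sq₀ (norm_nonneg _) (norm_nonneg _), hnorm, hnormT]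
    refine Finset.sum_congr rfl fun i _ => ?_
    rw [hP]
    split_ifs with hi
    · simp [hi]
    · ring
  · rw [← sq_le_sq₀ (norm_nonneg _) (mul_nonneg hγ (norm_nonneg _)), mul_pow, hnorm, hnormT,
      Finset.mul_sum]
    refine Finset.sum_le_sum fun i _ => ?_
    rw [inner_sub_right, hP]
    split_ifs with hi
    · simp
    · gcongr
      · exact T.singularValues_nonneg _
      · exact h i i.2 hi

end LinearMaps

/-! ### Rank-one matrices in the trace inner product -/

section RankOne

variable {n₁ n₂ : ℕ}

/-- The rank-one matrix `u vᵀ`. -/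
def outer (u : EuclideanSpace ℝ (Fin n₁)) (v : EuclideanSpace ℝ (Fin n₂)) :
    Matrix (Fin n₁) (Fin n₂) ℝ :=
  Matrix.vecMulVec u v

theorem inner_outer (Y : Matrix (Fin n₁) (Fin n₂) ℝ) (u : EuclideanSpace ℝ (Fin n₁))
    (v : EuclideanSpace ℝ (Fin n₂)) : inner ℝ Y (outer u v) = ⟪u, Y.toEuclideanLin v⟫ := by
  change (Y.transpose * Matrix.vecMulVec u v).trace = _
  rw [Matrix.mul_vecMulVec, Matrix.trace_vecMulVec, Matrix.mulVec_transpose,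
    ← Matrix.dotProduct_mulVec, EuclideanSpace.inner_eq_star_dotProduct,
    Matrix.ofLp_toLpLin, Matrix.toLin'_apply, dotProduct_comm]
  rfl

theorem toEuclideanLin_outer (u : EuclideanSpace ℝ (Fin n₁)) (v x : EuclideanSpace ℝ (Fin n₂)) :
    (outer u v).toEuclideanLin x = ⟪v, x⟫ • u := by
  rw [Matrix.toLpLin_apply, outer, Matrix.vecMulVec_mulVec,
    EuclideanSpace.inner_eq_star_dotProduct]
  ext i
  simp [mul_comm, dotProduct_comm]

theorem norm_outer (u : EuclideanSpace ℝ (Fin n₁)) (v : EuclideanSpace ℝ (Fin n₂)) :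
    ‖outer u v‖ = ‖u‖ * ‖v‖ := by
  rw [← sq_eq_sq₀ (norm_nonneg _) (by positivity), ← real_inner_self_eq_norm_sq, inner_outer,
    toEuclideanLin_outer, inner_smul_right, real_inner_self_eq_norm_sq, real_inner_self_eq_norm_sq]
  ring

theorem norm_toEuclideanLin_le (A : Matrix (Fin n₁) (Fin n₂) ℝ) (x : EuclideanSpace ℝ (Fin n₂)) :
    ‖A.toEuclideanLin x‖ ≤ ‖A‖ * ‖x‖ := by
  have h : ‖A.toEuclideanLin x‖ * ‖A.toEuclideanLin x‖
      ≤ ‖A.toEuclideanLin x‖ * (‖A‖ * ‖x‖) := by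
    calc _ = inner ℝ A (outer (A.toEuclideanLin x) x) := by
          rw [inner_outer, real_inner_self_eq_norm_mul_norm]
      _ ≤ ‖A‖ * (‖A.toEuclideanLin x‖ * ‖x‖) := by
          rw [← norm_outer]; exact real_inner_le_norm _ _
      _ = _ := by ring
  rcases (norm_nonneg (A.toEuclideanLin x)).eq_or_lt with h0 | h0
  · rw [← h0]; positivity
  · exact le_of_mul_le_mul_left h h0

theorem outer_sub_outer (u u' : EuclideanSpace ℝ (Fin n₁)) (v v' : EuclideanSpace ℝ (Fin n₂)) :
    outer u v - outer u' v' = outer (u - u') v + outer u' (v - v') := by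
  ext i j
  simp [outer, Matrix.vecMulVec_apply]
  ring

end RankOne

/-! ### The nuclear norm and its subgradients -/

section NuclearNorm

variable {n₁ n₂ : ℕ}

theorem sv_nonneg (X : Matrix (Fin n₁) (Fin n₂) ℝ) (i : ℕ) : 0 ≤ sv X i :=
  LinearMap.singularValues_nonneg _ i

theorem sv_antitone (X : Matrix (Fin n₁) (Fin n₂) ℝ) : Antitone (sv X) :=
  LinearMap.singularValues_antitone _

theorem sv_eq_zero (X : Matrix (Fin n₁) (Fin n₂) ℝ) {i : ℕ} (hi : min n₁ n₂ ≤ i) :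
    sv X i = 0 := by
  refine (LinearMap.singularValues_eq_zero_iff_le_finrank_range _).2 (le_trans (le_min ?_ ?_) hi)
  · simpa using Submodule.finrank_le (LinearMap.range X.toEuclideanLin)
  · simpa using LinearMap.finrank_range_le X.toEuclideanLin

theorem nuclearNorm_eq_sum (X : Matrix (Fin n₁) (Fin n₂) ℝ) :
    nuclearNorm X = ∑ i : Fin n₂, sv X i := by
  rw [← Finset.sum_range (fun i => sv X i)]
  refine Finset.sum_subset (Finset.range_mono (min_le_right _ _)) fun i _ hi => ?_
  exact sv_eq_zero X (not_lt.1 fun h => hi (Finset.mem_range.2 h))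

theorem nuclearNorm_nonneg (X : Matrix (Fin n₁) (Fin n₂) ℝ) : 0 ≤ nuclearNorm X :=
  Finset.sum_nonneg fun i _ => sv_nonneg X i

/-- Singular value decomposition of a matrix as a weighted sum of rank-one matrices. The left
singular vectors `u i` need only be unit vectors where the singular value is nonzero. -/
theorem exists_svd (X : Matrix (Fin n₁) (Fin n₂) ℝ) :
    ∃ (v : OrthonormalBasis (Fin n₂) ℝ (EuclideanSpace ℝ (Fin n₂)))
      (u : Fin n₂ → EuclideanSpace ℝ (Fin n₁)),
      X = ∑ i : Fin n₂, sv X i • outer (u i) (v i) ∧ (∀ i j, i ≠ j → ⟪u i, u j⟫ = 0) ∧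
      (∀ i, ‖u i‖ ≤ 1) ∧ (∀ i : Fin n₂, sv X i ≠ 0 → ‖u i‖ = 1) ∧
      nuclearNorm X = ∑ i, ⟪u i, X.toEuclideanLin (v i)⟫ := by
  obtain ⟨v, u, hT, horth, hle, hone⟩ :=
    exists_singularValueDecomposition X.toEuclideanLin (finrank_euclideanSpace_fin (𝕜 := ℝ))
  refine ⟨v, u, ?_, horth, hle, hone, ?_⟩
  · apply Matrix.toEuclideanLin.injective
    refine v.toBasis.ext fun j => ?_
    rw [map_sum, LinearMap.sum_apply, Finset.sum_eq_single j]
    · simp [toEuclideanLin_outer, hT, sv]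
    · intro i _ hij
      simp [toEuclideanLin_outer, hij]
    · simp
  · rw [nuclearNorm_eq_sum]
    refine Finset.sum_congr rfl fun i _ => ?_
    rw [hT, inner_smul_right, real_inner_self_eq_norm_sq]
    by_cases hi : sv X i = 0
    · rw [hi]; simp only [sv] at hi; simp [hi]
    · rw [hone i hi]; simp [sv]

/-- Duality between the nuclear norm and the operator norm. -/
theorem inner_le_nuclearNorm {Y : Matrix (Fin n₁) (Fin n₂) ℝ}
    (hY : ∀ x, ‖Y.toEuclideanLin x‖ ≤ ‖x‖) (X : Matrix (Fin n₁) (Fin n₂) ℝ) :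
    inner ℝ Y X ≤ nuclearNorm X := by
  obtain ⟨v, u, hX, -, hle, -, -⟩ := exists_svd X
  rw [nuclearNorm_eq_sum]
  conv_lhs => rw [hX]
  rw [inner_sum]
  refine Finset.sum_le_sum fun i _ => ?_
  rw [inner_smul_right, inner_outer]
  refine mul_le_of_le_one_right (sv_nonneg X i) ((real_inner_le_norm _ _).trans ?_)
  refine mul_le_one₀ (hle i) (norm_nonneg _) ((hY _).trans (v.norm_eq_one i).le)

/-- The supremum in the duality between the nuclear norm and the operator norm is attained, at
`∑ uᵢ vᵢᵀ`. -/
theorem exists_contraction_inner_eq_nuclearNorm (X : Matrix (Fin n₁) (Fin n₂) ℝ) :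
    ∃ W : Matrix (Fin n₁) (Fin n₂) ℝ, (∀ x, ‖W.toEuclideanLin x‖ ≤ ‖x‖) ∧
      inner ℝ W X = nuclearNorm X := by
  obtain ⟨v, u, -, horth, hle, -, hsum⟩ := exists_svd X
  refine ⟨∑ i, outer (u i) (v i), fun x => ?_, ?_⟩
  · rw [map_sum, LinearMap.sum_apply]
    simp only [toEuclideanLin_outer]
    exact norm_sum_inner_smul_le v horth hle x
  · rw [real_inner_comm, inner_sum, hsum]
    simp only [inner_outer]

theorem nuclearNorm_sum_smul_outer_le {ι : Type*} (s : Finset ι) {a : ι → ℝ} (ha : ∀ i, 0 ≤ a i)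
    (u : ι → EuclideanSpace ℝ (Fin n₁)) (v : ι → EuclideanSpace ℝ (Fin n₂)) :
    nuclearNorm (∑ i ∈ s, a i • outer (u i) (v i)) ≤ ∑ i ∈ s, a i * (‖u i‖ * ‖v i‖) := by
  obtain ⟨W, hW, h⟩ := exists_contraction_inner_eq_nuclearNorm (∑ i ∈ s, a i • outer (u i) (v i))
  rw [← h, inner_sum]
  refine Finset.sum_le_sum fun i _ => ?_
  rw [inner_smul_right, inner_outer]
  gcongr
  · exact ha i
  · exact (real_inner_le_norm _ _).trans (by gcongr; exact hW _)

theorem nuclearNorm_zero : nuclearNorm (0 : Matrix (Fin n₁) (Fin n₂) ℝ) = 0 := by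
  simp [nuclearNorm, sv]

theorem nuclearNorm_pos {X : Matrix (Fin n₁) (Fin n₂) ℝ} (hX : X ≠ 0) : 0 < nuclearNorm X := by
  refine (nuclearNorm_nonneg X).lt_of_ne fun h => hX ?_
  obtain ⟨v, u, hXsum, -⟩ := exists_svd X
  rw [nuclearNorm_eq_sum, eq_comm,
    Finset.sum_eq_zero_iff_of_nonneg fun (i : Fin n₂) _ => sv_nonneg X i] at h
  rw [hXsum]
  exact Finset.sum_eq_zero fun i hi => by rw [h i hi, zero_smul]

theorem nuclearNorm_two_smul_le (X : Matrix (Fin n₁) (Fin n₂) ℝ) :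
    nuclearNorm ((2 : ℝ) • X) ≤ 2 * nuclearNorm X := by
  obtain ⟨W, hW, h⟩ := exists_contraction_inner_eq_nuclearNorm ((2 : ℝ) • X)
  rw [← h, inner_smul_right]
  gcongr
  exact inner_le_nuclearNorm hW X

theorem nuclearNorm_le (X : Matrix (Fin n₁) (Fin n₂) ℝ) : nuclearNorm X ≤ n₂ * ‖X‖ := by
  obtain ⟨v, u, -, -, hle, -, hsum⟩ := exists_svd X
  rw [hsum]
  refine (Finset.sum_le_card_nsmul _ _ ‖X‖ fun i _ => ?_).trans (by simp)
  refine (real_inner_le_norm _ _).trans ?_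
  refine (mul_le_of_le_one_left (norm_nonneg _) (hle i)).trans ?_
  simpa using norm_toEuclideanLin_le X (v i)

/-- The subgradients of the nuclear norm at `X` are the contractions `Y` with `⟪Y, X⟫ = ‖X‖_*`. -/
theorem mem_subdifferential_nuclearNorm_iff {X Y : Matrix (Fin n₁) (Fin n₂) ℝ} :
    Y ∈ subdifferential nuclearNorm X ↔
      (∀ x, ‖Y.toEuclideanLin x‖ ≤ ‖x‖) ∧ inner ℝ Y X = nuclearNorm X := by
  constructor
  · intro h
    -- Testing at `0` and at `2 • X` gives the two inequalities of `⟪Y, X⟫ = ‖X‖_*`.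
    have h0 := h 0
    have h2 := h ((2 : ℝ) • X)
    have h2' := nuclearNorm_two_smul_le X
    rw [nuclearNorm_zero, inner_sub_right, inner_zero_right] at h0
    rw [inner_sub_right, inner_smul_right] at h2
    have heq : inner ℝ Y X = nuclearNorm X := by linarith
    refine ⟨fun x => ?_, heq⟩
    -- Test the subgradient inequality on the rank-one matrix `(Y x) xᵀ`.
    have h1 := h (outer (Y.toEuclideanLin x) x)
    have h1' : nuclearNorm (outer (Y.toEuclideanLin x) x) ≤ ‖Y.toEuclideanLin x‖ * ‖x‖ := by
      simpa using nuclearNorm_sum_smul_outer_le (Finset.univ : Finset Unit)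
        (a := fun _ => 1) (fun _ => zero_le_one) (fun _ => Y.toEuclideanLin x) (fun _ => x)
    rw [inner_sub_right, inner_outer, real_inner_self_eq_norm_mul_norm] at h1
    rcases (norm_nonneg (Y.toEuclideanLin x)).eq_or_lt with h0 | h0
    · rw [← h0]; positivity
    · exact le_of_mul_le_mul_left (by linarith) h0
  · rintro ⟨hY, hX⟩ U
    rw [inner_sub_right, hX]
    linarith [inner_le_nuclearNorm hY U]

end NuclearNorm

/-! ### The subdominant singular value -/

section Subdominant

variable {n₁ n₂ : ℕ}

theorem sv_le_one {Y : Matrix (Fin n₁) (Fin n₂) ℝ} (hY : ∀ x, ‖Y.toEuclideanLin x‖ ≤ ‖x‖)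
    (i : ℕ) : sv Y i ≤ 1 := by
  refine (singularValues_le_add Y.toEuclideanLin 0 zero_le_one (fun x => ?_) i).trans (by simp)
  simpa using hY x

theorem subdominant_le_iff {Y : Matrix (Fin n₁) (Fin n₂) ℝ} {c : ℝ} :
    subdominant Y ≤ c ↔ 0 ≤ c ∧ ∀ i < min n₁ n₂, sv Y i ≠ 1 → sv Y i ≤ c := by
  rw [subdominant, Finset.max'_le_iff]
  simp only [Finset.mem_insert, Finset.mem_erase, Finset.mem_image, Finset.mem_range]
  constructor
  · exact fun h => ⟨h 0 (Or.inl rfl), fun i hi h1 => h _ (Or.inr ⟨h1, i, hi, rfl⟩)⟩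
  · rintro ⟨h0, h⟩ _ (rfl | ⟨h1, i, hi, rfl⟩)
    exacts [h0, h i hi h1]

theorem subdominant_nonneg (Y : Matrix (Fin n₁) (Fin n₂) ℝ) : 0 ≤ subdominant Y :=
  (subdominant_le_iff.1 le_rfl).1

theorem sv_le_subdominant {Y : Matrix (Fin n₁) (Fin n₂) ℝ} {i : ℕ} (hi : sv Y i ≠ 1) :
    sv Y i ≤ subdominant Y := by
  rcases lt_or_ge i (min n₁ n₂) with h | h
  · exact (subdominant_le_iff.1 le_rfl).2 i h hi
  · rw [sv_eq_zero Y h]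
    exact subdominant_nonneg Y

theorem subdominant_lt_one {Y : Matrix (Fin n₁) (Fin n₂) ℝ}
    (hY : ∀ x, ‖Y.toEuclideanLin x‖ ≤ ‖x‖) : subdominant Y < 1 := by
  rw [subdominant, Finset.max'_lt_iff]
  simp only [Finset.mem_insert, Finset.mem_erase, Finset.mem_image, Finset.mem_range]
  rintro _ (rfl | ⟨h1, i, hi, rfl⟩)
  exacts [zero_lt_one, (sv_le_one hY i).lt_of_ne h1]

/-- The ones among the singular values of a contraction are the leading ones. -/
theorem sv_eq_one_iff {Y : Matrix (Fin n₁) (Fin n₂) ℝ} (hY : ∀ x, ‖Y.toEuclideanLin x‖ ≤ ‖x‖)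
    {i : ℕ} : sv Y i = 1 ↔ i < numOnes Y := by
  constructor
  · intro h
    have hsub : Finset.range (i + 1) ⊆
        (Finset.range (min n₁ n₂)).filter fun j => sv Y j = 1 := by
      intro j hj
      have h1 : sv Y j = 1 := le_antisymm (sv_le_one hY j)
        (h ▸ sv_antitone Y (Nat.lt_succ_iff.1 (Finset.mem_range.1 hj)))
      refine Finset.mem_filter.2 ⟨Finset.mem_range.2 (not_le.1 fun hle => ?_), h1⟩
      rw [sv_eq_zero Y hle] at h1
      exact zero_ne_one h1
    simpa [numOnes] using Finset.card_le_card hsub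
  · intro h
    by_contra hne
    have hsub : ((Finset.range (min n₁ n₂)).filter fun j => sv Y j = 1) ⊆ Finset.range i := by
      intro j hj
      rw [Finset.mem_range]
      by_contra hij
      have h1 := (Finset.mem_filter.1 hj).2
      exact hne (le_antisymm (sv_le_one hY i) (h1 ▸ sv_antitone Y (not_lt.1 hij)))
    have := Finset.card_le_card hsub
    rw [Finset.card_range] at this
    exact absurd h (not_lt.2 this)

/-- On `topOnes Y₀`, the subdominant singular value exceeds that at `Y₀` by at most the distance to
`Y₀`. Membership matters: elsewhere a singular value `1` of `Y₀` may move to just below `1`. -/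
theorem subdominant_le_of_mem_topOnes {Y₀ Y : Matrix (Fin n₁) (Fin n₂) ℝ}
    (hY₀ : ∀ x, ‖Y₀.toEuclideanLin x‖ ≤ ‖x‖) (hY : Y ∈ topOnes Y₀) :
    subdominant Y ≤ subdominant Y₀ + ‖Y - Y₀‖ := by
  have h0 := subdominant_nonneg Y₀
  refine subdominant_le_iff.2 ⟨by positivity, fun i _ hi => ?_⟩
  have hp : numOnes Y₀ ≤ i := not_lt.1 fun h => hi (hY i h)
  calc sv Y i ≤ sv Y₀ i + ‖Y - Y₀‖ :=
        singularValues_le_add _ _ (norm_nonneg _)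
          (fun x => by simpa using norm_toEuclideanLin_le (Y - Y₀) x) i
    _ ≤ _ := by
        gcongr
        exact sv_le_subdominant fun h => absurd ((sv_eq_one_iff hY₀).1 h) (not_lt.2 hp)

end Subdominant

/-! ### Quadratic growth of the nuclear norm -/

section Growth

variable {n₁ n₂ : ℕ}

/-- The estimate for a single pair of singular vectors; `w` plays the role of the projection of `v`
onto the right singular vectors of `Y` with singular value `1`. -/
theorem norm_outer_sub_outer_sq_le {Y : Matrix (Fin n₁) (Fin n₂) ℝ} {γ : ℝ} (hγ0 : 0 ≤ γ)
    (hγ1 : γ < 1) {u : EuclideanSpace ℝ (Fin n₁)} {v w : EuclideanSpace ℝ (Fin n₂)}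
    (hu : ‖u‖ = 1) (hv : ‖v‖ = 1) (hsplit : ‖v‖ ^ 2 = ‖w‖ ^ 2 + ‖v - w‖ ^ 2)
    (hYv : ‖Y.toEuclideanLin v‖ ^ 2 = ‖w‖ ^ 2 + ‖Y.toEuclideanLin (v - w)‖ ^ 2)
    (hYw : ‖Y.toEuclideanLin w‖ = ‖w‖) (hsub : ‖Y.toEuclideanLin (v - w)‖ ≤ γ * ‖v - w‖) :
    (1 - γ ^ 2) * ‖outer u v - outer (Y.toEuclideanLin w) w‖ ^ 2 ≤
      2 * (1 + (1 + γ) ^ 2) * (1 - ⟪u, Y.toEuclideanLin v⟫) := by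
  set T := Y.toEuclideanLin
  set x := ‖u - T v‖ with hx
  set y := ‖v - w‖ with hy
  have hx0 : 0 ≤ x := norm_nonneg _
  have hy0 : 0 ≤ y := norm_nonneg _
  have hw1 : ‖w‖ ≤ 1 := by nlinarith [norm_nonneg w]
  have hd : ‖outer u v - outer (T w) w‖ ≤ x + (1 + γ) * y := by
    rw [outer_sub_outer]
    refine (norm_add_le _ _).trans ?_
    rw [norm_outer, norm_outer, hv, mul_one, hYw]
    have h1 : ‖u - T w‖ ≤ x + γ * y := by
      have : u - T w = (u - T v) + T (v - w) := by rw [map_sub]; abel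
      rw [this]
      exact (norm_add_le _ _).trans (by gcongr)
    have h2 : ‖w‖ * y ≤ y := mul_le_of_le_one_left hy0 hw1
    linarith
  have hdefect : x ^ 2 + (1 - γ ^ 2) * y ^ 2 ≤ 2 * (1 - ⟪u, T v⟫) := by
    have h1 : x ^ 2 = 1 - 2 * ⟪u, T v⟫ + ‖T v‖ ^ 2 := by
      rw [hx, norm_sub_sq_real, hu]; ring
    have h2 : ‖T (v - w)‖ ^ 2 ≤ γ ^ 2 * y ^ 2 := by
      rw [← mul_pow]; gcongr
    rw [hv] at hsplit
    nlinarith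
  have hγ2 : 0 < 1 - γ ^ 2 := by nlinarith
  -- Cauchy-Schwarz gives the smaller constant `2 * (1 + γ)`, and `1 + (1 + γ) ^ 2` is `γ ^ 2` more.
  have hcs : (1 - γ ^ 2) * (x + (1 + γ) * y) ^ 2 ≤
      (1 + (1 + γ) ^ 2) * (x ^ 2 + (1 - γ ^ 2) * y ^ 2) := by
    nlinarith [sq_nonneg ((1 + γ) * x - (1 - γ ^ 2) * y), sq_nonneg (γ * x),
      mul_nonneg (sq_nonneg γ) (mul_nonneg hγ2.le (sq_nonneg y))]
  calc (1 - γ ^ 2) * ‖outer u v - outer (T w) w‖ ^ 2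
      ≤ (1 - γ ^ 2) * (x + (1 + γ) * y) ^ 2 := by gcongr
    _ ≤ (1 + (1 + γ) ^ 2) * (x ^ 2 + (1 - γ ^ 2) * y ^ 2) := hcs
    _ ≤ (1 + (1 + γ) ^ 2) * (2 * (1 - ⟪u, T v⟫)) := by gcongr
    _ = _ := by ring

/-- The first growth inequality with the denominators cleared, valid for `X = 0` as well. -/
theorem infDist_sq_le {Y : Matrix (Fin n₁) (Fin n₂) ℝ} (hY : ∀ x, ‖Y.toEuclideanLin x‖ ≤ ‖x‖)
    (X : Matrix (Fin n₁) (Fin n₂) ℝ) :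
    (1 - subdominant Y ^ 2) * Metric.infDist X (subdifferentialInv nuclearNorm Y) ^ 2 ≤
      2 * nuclearNorm X * (1 + (1 + subdominant Y) ^ 2) * (nuclearNorm X - inner ℝ Y X) := by
  set γ := subdominant Y
  have hγ0 : 0 ≤ γ := subdominant_nonneg Y
  have hγ1 : γ < 1 := subdominant_lt_one hY
  obtain ⟨P, hP⟩ := exists_splitting Y.toEuclideanLin hγ0
    fun i _ hi => sv_le_subdominant (Y := Y) hi
  obtain ⟨v, u, hX, -, -, hone, -⟩ := exists_svd X
  set T := Y.toEuclideanLin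
  set Z : Matrix (Fin n₁) (Fin n₂) ℝ := ∑ i : Fin n₂, sv X i • outer (T (P (v i))) (P (v i)) with hZ
  have hZmem : Z ∈ subdifferentialInv nuclearNorm Y := by
    refine mem_subdifferential_nuclearNorm_iff.2 ⟨hY, (inner_le_nuclearNorm hY Z).antisymm ?_⟩
    refine (nuclearNorm_sum_smul_outer_le _ (fun i => sv_nonneg X _) _ _).trans_eq ?_
    rw [hZ, inner_sum]
    refine Finset.sum_congr rfl fun i _ => ?_
    rw [inner_smul_right, inner_outer, real_inner_self_eq_norm_mul_norm, (hP _).2.2.1]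
  set d : Fin n₂ → ℝ := fun i => ‖outer (u i) (v i) - outer (T (P (v i))) (P (v i))‖
  have hdist :
      Metric.infDist X (subdifferentialInv nuclearNorm Y) ≤ ∑ i : Fin n₂, sv X i * d i := by
    refine (Metric.infDist_le_dist_of_mem hZmem).trans ?_
    rw [dist_eq_norm]
    conv_lhs => rw [hX]
    rw [hZ, ← Finset.sum_sub_distrib]
    refine (norm_sum_le _ _).trans_eq (Finset.sum_congr rfl fun i _ => ?_)
    rw [← smul_sub, norm_smul, Real.norm_of_nonneg (sv_nonneg X i)]
  have hcs : (∑ i : Fin n₂, sv X i * d i) ^ 2 ≤ nuclearNorm X * ∑ i : Fin n₂, sv X i * d i ^ 2 := by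
    rw [nuclearNorm_eq_sum]
    exact Finset.sum_sq_le_sum_mul_sum_of_sq_le_mul _ (fun i _ => sv_nonneg X i)
      (fun i _ => mul_nonneg (sv_nonneg X i) (sq_nonneg _)) fun i _ => (by ring : _ = _).le
  have hdefect : nuclearNorm X - inner ℝ Y X = ∑ i : Fin n₂, sv X i * (1 - ⟪u i, T (v i)⟫) := by
    conv_lhs => enter [2]; rw [hX]
    rw [nuclearNorm_eq_sum, inner_sum, ← Finset.sum_sub_distrib]
    refine Finset.sum_congr rfl fun i _ => ?_
    rw [inner_smul_right, inner_outer]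
    ring
  have hγ2 : 0 < 1 - γ ^ 2 := by nlinarith
  have hterm (i : Fin n₂) : sv X i * ((1 - γ ^ 2) * d i ^ 2) ≤
      sv X i * (2 * (1 + (1 + γ) ^ 2) * (1 - ⟪u i, T (v i)⟫)) := by
    by_cases hi : sv X i = 0
    · simp [hi]
    · refine mul_le_mul_of_nonneg_left ?_ (sv_nonneg X i)
      obtain ⟨h1, h2, h3, h4⟩ := hP (v i)
      exact norm_outer_sub_outer_sq_le hγ0 hγ1 (hone i hi) (v.norm_eq_one i) h1 h2 h3 h4
  calc (1 - γ ^ 2) * Metric.infDist X (subdifferentialInv nuclearNorm Y) ^ 2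
      ≤ (1 - γ ^ 2) * (nuclearNorm X * ∑ i : Fin n₂, sv X i * d i ^ 2) := by
        gcongr
        exact (pow_le_pow_left₀ Metric.infDist_nonneg hdist 2).trans hcs
    _ = nuclearNorm X * ∑ i : Fin n₂, sv X i * ((1 - γ ^ 2) * d i ^ 2) := by
        rw [mul_left_comm, Finset.mul_sum]
        congr 1
        exact Finset.sum_congr rfl fun i _ => by ring
    _ ≤ nuclearNorm X *
        ∑ i : Fin n₂, sv X i * (2 * (1 + (1 + γ) ^ 2) * (1 - ⟪u i, T (v i)⟫)) :=
        mul_le_mul_of_nonneg_left (Finset.sum_le_sum fun i _ => hterm i) (nuclearNorm_nonneg X)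
    _ = _ := by
        rw [hdefect, Finset.mul_sum, Finset.mul_sum]
        exact Finset.sum_congr rfl fun i _ => by ring

/-- The second growth inequality with the denominators cleared, valid for `X = 0` as well. -/
theorem one_sub_mul_infDist_sq_le {Y : Matrix (Fin n₁) (Fin n₂) ℝ}
    (hY : ∀ x, ‖Y.toEuclideanLin x‖ ≤ ‖x‖) (X : Matrix (Fin n₁) (Fin n₂) ℝ) :
    (1 - subdominant Y) * Metric.infDist X (subdifferentialInv nuclearNorm Y) ^ 2 ≤
      5 * nuclearNorm X * (nuclearNorm X - inner ℝ Y X) := by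
  have h := infDist_sq_le hY X
  have hγ0 := subdominant_nonneg Y
  have hγ1 := subdominant_lt_one hY
  have hA := mul_nonneg (nuclearNorm_nonneg X) (sub_nonneg.2 (inner_le_nuclearNorm hY X))
  generalize subdominant Y = γ at *
  -- `2 * (1 + t ^ 2) ≤ 5 * t` on `[1, 2]`, with `t = 1 + γ`.
  have ht : 2 * (1 + (1 + γ) ^ 2) ≤ 5 * (1 + γ) := by nlinarith
  have h1 : 0 < 1 + γ := by linarith
  refine le_of_mul_le_mul_left ?_ h1
  calc _ = (1 - γ ^ 2) * Metric.infDist X (subdifferentialInv nuclearNorm Y) ^ 2 := by ring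
    _ ≤ _ := h
    _ = 2 * (1 + (1 + γ) ^ 2) * (nuclearNorm X * (nuclearNorm X - inner ℝ Y X)) := by ring
    _ ≤ 5 * (1 + γ) * (nuclearNorm X * (nuclearNorm X - inner ℝ Y X)) := by gcongr
    _ = _ := by ring

theorem quadraticGrowthAround_nuclearNorm {X₀ Y₀ : Matrix (Fin n₁) (Fin n₂) ℝ}
    (h₀ : Y₀ ∈ subdifferential nuclearNorm X₀) :
    QuadraticGrowthAround nuclearNorm X₀ Y₀ (topOnes Y₀) := by
  have hY₀ := (mem_subdifferential_nuclearNorm_iff.1 h₀).1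
  have hγ1 := subdominant_lt_one hY₀
  set γ := subdominant Y₀
  have hL : 0 < ((n₂ : ℝ) + 1) * (‖X₀‖ + 2) := by positivity
  set L := ((n₂ : ℝ) + 1) * (‖X₀‖ + 2) with hLdef
  refine ⟨h₀, fun i hi => (sv_eq_one_iff hY₀).2 hi, min 1 ((1 - γ) / 2),
    lt_min one_pos (by linarith), (1 - γ) / (5 * L), div_pos (by linarith) (by positivity), ?_⟩
  intro X Y hXY hball hYM
  obtain ⟨hY, hYX⟩ := mem_subdifferential_nuclearNorm_iff.1 hXY
  rw [Metric.mem_ball, Prod.dist_eq, max_lt_iff, lt_min_iff, lt_min_iff] at hball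
  have hX1 : ‖X - X₀‖ < 1 := by rw [← dist_eq_norm]; exact hball.1.1
  have hY1 : ‖Y - Y₀‖ < (1 - γ) / 2 := by rw [← dist_eq_norm]; exact hball.2.2
  refine ⟨1, one_pos, fun U hU => ?_⟩
  have hU1 : ‖U - X‖ < 1 := by rw [← dist_eq_norm]; exact hU
  have hUL : nuclearNorm U ≤ L := by
    have h1 := norm_le_norm_add_norm_sub' U X
    have h2 := norm_le_norm_add_norm_sub' X X₀
    refine (nuclearNorm_le U).trans ?_
    rw [hLdef]
    gcongr <;> linarith
  have hγY : subdominant Y ≤ γ + (1 - γ) / 2 :=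
    (subdominant_le_of_mem_topOnes hY₀ hYM).trans (by gcongr)
  have hδ := sub_nonneg.2 (inner_le_nuclearNorm hY U)
  rw [inner_sub_right, hYX]
  set D := Metric.infDist U (subdifferentialInv nuclearNorm Y)
  have key : (1 - γ) / 2 * D ^ 2 ≤ 5 * L * (nuclearNorm U - inner ℝ Y U) := by
    calc (1 - γ) / 2 * D ^ 2 ≤ (1 - subdominant Y) * D ^ 2 := by gcongr; linarith
      _ ≤ 5 * nuclearNorm U * (nuclearNorm U - inner ℝ Y U) := one_sub_mul_infDist_sq_le hY U
      _ ≤ _ := by gcongr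
  have : (1 - γ) / (5 * L) / 2 * D ^ 2 = (1 - γ) / 2 * D ^ 2 / (5 * L) := by ring
  rw [this, div_le_iff₀ (by positivity)]
  linarith

end Growth

theorem lemma4p2 {n₁ n₂ : ℕ} (X₀ Y₀ : Matrix (Fin n₁) (Fin n₂) ℝ)
    (hY₀ : Y₀ ∈ subdifferential nuclearNorm X₀) :
    subdominant Y₀ < 1 ∧
    (∀ X : Matrix (Fin n₁) (Fin n₂) ℝ, X ≠ 0 →
      nuclearNorm X - nuclearNorm X₀ - inner ℝ Y₀ (X - X₀) ≥
        (1 - subdominant Y₀ ^ 2) / (2 * nuclearNorm X * (1 + (1 + subdominant Y₀) ^ 2)) *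
          Metric.infDist X (subdifferentialInv nuclearNorm Y₀) ^ 2) ∧
    (∀ X : Matrix (Fin n₁) (Fin n₂) ℝ, X ≠ 0 →
      nuclearNorm X - nuclearNorm X₀ - inner ℝ Y₀ (X - X₀) ≥
        (1 - subdominant Y₀) / (5 * nuclearNorm X) *
          Metric.infDist X (subdifferentialInv nuclearNorm Y₀) ^ 2) ∧
    QuadraticGrowthAround nuclearNorm X₀ Y₀ (topOnes Y₀) := by
  obtain ⟨hY, hX₀⟩ := mem_subdifferential_nuclearNorm_iff.1 hY₀
  have hgap (X : Matrix (Fin n₁) (Fin n₂) ℝ) :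
      nuclearNorm X - nuclearNorm X₀ - inner ℝ Y₀ (X - X₀) = nuclearNorm X - inner ℝ Y₀ X := by
    rw [inner_sub_right, hX₀]; ring
  refine ⟨subdominant_lt_one hY, fun X hX => ?_, fun X hX => ?_,
    quadraticGrowthAround_nuclearNorm hY₀⟩
  · have hpos := nuclearNorm_pos hX
    rw [hgap, ge_iff_le, div_mul_eq_mul_div, div_le_iff₀ (by positivity),
      mul_comm (nuclearNorm X - _)]
    exact infDist_sq_le hY X
  · have hpos := nuclearNorm_pos hX
    rw [hgap, ge_iff_le, div_mul_eq_mul_div, div_le_iff₀ (by positivity),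
      mul_comm (nuclearNorm X - _)]
    exact one_sub_mul_infDist_sq_le hY X
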